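/- Let $\mathcal H_S,\mathcal H_M$ be complex Hilbert spaces (observed system and measuring device), let $\mathcal H=\mathcal H_S\otimes\mathcal H_M$ be their Hilbert space tensor product, and let $\hbar>0$. Let $H$ be a self-adjoint operator on $\mathcal H$ that is bounded from below, and $U_t=e^{-\frac{i}{\hbar}tH}$. Let $A$ be a sharp observable on $\mathcal H_S$ (measured observable) and $Z$ a sharp observable on $\mathcal H_M$ (pointer observable), with spectral projections $P_B$ and $\Pi_B$ for Borel sets $B\subseteq\mathbb R$ (so $P_{\{\lambda\}}=P_\lambda$ is the eigenprojection if $A=\sum_\lambda\lambda P_\lambda$). Let $R\subseteq\mathbb R$ be a Borel set with $\Pi_R\neq0$ (the "ready" values of the pointer, e.g. one eigenvalue), let $B\subseteq\mathbb R$ be a Borel set disjoint from $R$ (e.g. one eigenvalue $\lambda$ of $A$), and let $T<T'$. For an initial density operator $\rho_0$ on $\mathcal H$ put $\rho(t)=U_t\rho_0U_t^\dagger$ and $\widetilde\Pi_B=I_S\otimes\Pi_B$, and consider the conditions (a) (ready) $\operatorname{tr}_S\rho_0=\Pi_R(\operatorname{tr}_S\rho_0)\Pi_R^\dagger$; (b)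 (system initially in $B$) $\operatorname{tr}_M\rho_0=P_B(\operatorname{tr}_M\rho_0)P_B^\dagger$; (c) (pointer indicates $B$ at $T$) $\rho(T)=\widetilde\Pi_B\,\rho(T)\,\widetilde\Pi_B^\dagger$; (d) (pointer persistence) $\operatorname{tr}_S\rho(t)=\Pi_B(\operatorname{tr}_S\rho(t))\Pi_B^\dagger$ for all $t\in(T,T')$. Let $\rho_B=\widetilde\Pi_B\,\rho(T)\,\widetilde\Pi_B^\dagger$ be the unnormalized state left at the time $T$ by the projection postulate, and consider also (e) (the result $B$ occurs) $\rho_B\neq0$; (f) (system left in $B$) $\operatorname{tr}_M\rho_B=P_B(\operatorname{tr}_M\rho_B)P_B^\dagger$; (g) (pointer persistence after projection) $\operatorname{tr}_S\sigma(t)=\Pi_B(\operatorname{tr}_S\sigma(t))\Pi_B^\dagger$ for all $t\in(T,T')$, where $\sigma(t)=U_{t-T}\,\rho_B\,U_{t-T}^\dagger$. Then accurate measurements and accurate preparations of mixed states are impossible, in the following sense. 1. No density operator $\rho_0$ satisfies (a), (b), (c) and (d). 2. If $P_B\neq0$, it is not true that for every density operator $\rho_0$ satisfying (a), first, (b) holds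 if and only if (c) holds, and second, (b) implies (d). 3. No density operator $\rho_0$ satisfies (a), (e), (f) and (g). 4. It is not true that some density operator $\rho_0$ satisfies (a) and (e), and that every density operator $\rho_0$ satisfying (a) and (e) satisfies (f) and (g). -/

import Mathlib

open scoped TensorProduct InnerProductSpace

noncomputable section

namespace QuantumMeasurement

universe u v

/-! ### Hilbert space tensor product -/

section Tensor

variable (S : Type u) (M : Type v)
  [NormedAddCommGroup S] [InnerProductSpace ℂ S]
  [NormedAddCommGroup M] [InnerProductSpace ℂ M]

/-- The Hilbert space tensor product: the completion of the algebraic tensor product with respect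
to the inner product `⟪x ⊗ y, x' ⊗ y'⟫ = ⟪x, x'⟫ ⟪y, y'⟫`. -/
abbrev HTensor : Type (max u v) := UniformSpace.Completion (S ⊗[ℂ] M)

variable {S M}

/-- For fixed `x`, the bounded operator `y ↦ x ⊗ y`. -/
def tmulLeft (x : S) : M →L[ℂ] HTensor S M :=
  UniformSpace.Completion.toComplL ∘L TensorProduct.mkL ℂ S M x

/-- For fixed `y`, the bounded operator `x ↦ x ⊗ y`. -/
def tmulRight (y : M) : S →L[ℂ] HTensor S M :=
  UniformSpace.Completion.toComplL ∘L (TensorProduct.mkL ℂ S M).flip y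

/-- The operator `I_S ⊗ Q` for a bounded operator `Q` on the second factor. -/
def onPointer (Q : M →L[ℂ] M) : HTensor S M →L[ℂ] HTensor S M :=
  (TensorProduct.mapL (ContinuousLinearMap.id ℂ S) Q).completion

end Tensor

/-! ### Trace, density operators, partial traces -/

section Trace

variable (E : Type u) [NormedAddCommGroup E] [InnerProductSpace ℂ E] [CompleteSpace E]

/-- An index set of an orthonormal (Hilbert) basis of `E`. -/
def basisSet : Set E := (exists_hilbertBasis ℂ E).choose

/-- An orthonormal (Hilbert) basis of `E`. Traces and partial traces of positive trace-class
operators do not depend on the choice of the basis. -/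
def stdBasis : HilbertBasis (basisSet E) ℂ E := (exists_hilbertBasis ℂ E).choose_spec.choose

variable {E}

/-- A density operator: a positive (hence self-adjoint) bounded operator with trace one. -/
structure IsDensityOperator (ρ : E →L[ℂ] E) : Prop where
  isPositive : ρ.IsPositive
  trace_eq_one : HasSum (fun i => ⟪stdBasis E i, ρ (stdBasis E i)⟫_ℂ) 1

end Trace

section PartialTrace

variable {S : Type u} {M : Type v}
  [NormedAddCommGroup S] [InnerProductSpace ℂ S] [CompleteSpace S]
  [NormedAddCommGroup M] [InnerProductSpace ℂ M] [CompleteSpace M]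

/-- Partial trace over the first factor, `tr_S ρ = ∑ᵢ ⟨eᵢ| ρ |eᵢ⟩` with `(eᵢ)` an orthonormal basis
of `S`; the series converges absolutely in operator norm if `ρ` is positive and trace class
(`summable_traceS`). -/
def traceS (ρ : HTensor S M →L[ℂ] HTensor S M) : M →L[ℂ] M :=
  ∑' i, (tmulLeft (M := M) (stdBasis S i)).adjoint ∘L ρ ∘L tmulLeft (stdBasis S i)

/-- Partial trace over the second factor, `tr_M ρ = ∑ⱼ ⟨fⱼ| ρ |fⱼ⟩` with `(fⱼ)` an orthonormal basis
of `M` (see `summable_traceM` for the convergence). -/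
def traceM (ρ : HTensor S M →L[ℂ] HTensor S M) : S →L[ℂ] S :=
  ∑' j, (tmulRight (S := S) (stdBasis M j)).adjoint ∘L ρ ∘L tmulRight (stdBasis M j)

end PartialTrace

/-! ### Convergence of the series that define the partial traces -/

section Convergence

variable {E : Type u} [NormedAddCommGroup E] [InnerProductSpace ℂ E] [CompleteSpace E]
variable {F : Type v} [NormedAddCommGroup F] [InnerProductSpace ℂ F] [CompleteSpace F]

theorem tsum_enorm_inner_le {ι : Type*} {e : ι → E} (he : Orthonormal ℂ e) (x : E) :
    ∑' i, ‖⟪e i, x⟫_ℂ‖ₑ ^ 2 ≤ ‖x‖ₑ ^ 2 := by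
  refine ENNReal.summable.tsum_le_of_sum_le fun s => ?_
  have h := he.sum_inner_products_le (s := s) x
  have h2 : ∑ i ∈ s, ‖⟪e i, x⟫_ℂ‖₊ ^ 2 ≤ ‖x‖₊ ^ 2 := by
    rw [← NNReal.coe_le_coe]
    push_cast
    exact h
  simp only [enorm_eq_nnnorm]
  exact_mod_cast h2

theorem tsum_enorm_inner_eq {ι : Type*} (b : HilbertBasis ι ℂ E) (x : E) :
    ∑' i, ‖⟪b i, x⟫_ℂ‖ₑ ^ 2 = ‖x‖ₑ ^ 2 := by
  have h : HasSum (fun i => ‖⟪b i, x⟫_ℂ‖₊ ^ 2) (‖x‖₊ ^ 2) := by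
    rw [← NNReal.hasSum_coe]
    have h2 := Complex.hasSum_re (b.hasSum_inner_mul_inner x x)
    convert h2 using 1
    · ext i
      rw [← inner_conj_symm x (b i), ← Complex.normSq_eq_conj_mul_self, Complex.normSq_eq_norm_sq,
        Complex.ofReal_re]
      simp
    · rw [inner_self_eq_norm_sq_to_K]
      norm_cast
  have h3 := (ENNReal.hasSum_coe.2 h).tsum_eq
  simpa [enorm_eq_nnnorm] using h3

theorem enorm_sq_le_tsum {ι : Type*} (b : HilbertBasis ι ℂ E) (A : E →L[ℂ] F) :
    ‖A‖ₑ ^ 2 ≤ ∑' i, ‖A (b i)‖ₑ ^ 2 := by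
  have key : ∀ x, ‖A.adjoint x‖ₑ ^ 2 ≤ (∑' i, ‖A (b i)‖ₑ ^ 2) * ‖x‖ₑ ^ 2 := fun x => by
    rw [← tsum_enorm_inner_eq b, ← ENNReal.tsum_mul_right]
    refine ENNReal.tsum_le_tsum fun i => ?_
    rw [ContinuousLinearMap.adjoint_inner_right, ← mul_pow]
    gcongr
    simp only [enorm_eq_nnnorm]
    exact_mod_cast nnnorm_inner_le_nnnorm _ _
  rcases eq_or_ne (∑' i, ‖A (b i)‖ₑ ^ 2) ⊤ with h | h
  · simp [h]
  lift (∑' i, ‖A (b i)‖ₑ ^ 2) to NNReal using h with c hc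
  have h1 : ‖A.adjoint‖₊ ≤ NNReal.sqrt c := by
    refine ContinuousLinearMap.opNNNorm_le_bound _ _ fun x => ?_
    have := key x
    simp only [enorm_eq_nnnorm] at this
    have h2 : ‖A.adjoint x‖₊ ^ 2 ≤ c * ‖x‖₊ ^ 2 := by exact_mod_cast this
    rw [← NNReal.sqrt_sq ‖x‖₊, ← NNReal.sqrt_mul]
    exact NNReal.le_sqrt_iff_sq_le.2 h2
  have h3 : ‖A‖₊ ≤ NNReal.sqrt c := by
    refine le_trans (le_of_eq ?_) h1
    exact NNReal.eq (ContinuousLinearMap.adjoint.norm_map A).symm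
  rw [enorm_eq_nnnorm]
  exact_mod_cast NNReal.le_sqrt_iff_sq_le.1 h3

/-- If the vectors `V i (b j)` are orthonormal, then `∑ᵢ Vᵢ† ρ Vᵢ` converges absolutely in operator
norm. -/
theorem IsDensityOperator.summable_compress {ρ : E →L[ℂ] E} (hρ : IsDensityOperator ρ)
    {ι κ : Type*} (b : HilbertBasis κ ℂ F) (V : ι → F →L[ℂ] E)
    (hV : Orthonormal ℂ fun p : ι × κ => V p.1 (b p.2)) :
    Summable fun i => ‖(V i).adjoint ∘L ρ ∘L V i‖ := by
  obtain ⟨C, hCsa, hC⟩ : ∃ C : E →L[ℂ] E, C.adjoint = C ∧ C ∘L C = ρ :=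
    ⟨CFC.sqrt ρ,
      (CFC.sqrt_nonneg ρ).isSelfAdjoint,
      CFC.sqrt_mul_sqrt_self ρ ((ContinuousLinearMap.nonneg_iff_isPositive ρ).2 hρ.isPositive)⟩
  have hnorm : ∀ i, ‖(V i).adjoint ∘L ρ ∘L V i‖ₑ = ‖C ∘L V i‖ₑ ^ 2 := fun i => by
    have h1 : (V i).adjoint ∘L ρ ∘L V i = (C ∘L V i).adjoint ∘L (C ∘L V i) := by
      rw [ContinuousLinearMap.adjoint_comp, hCsa, ← hC]; rfl
    rw [h1, enorm_eq_nnnorm, enorm_eq_nnnorm]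
    have := ContinuousLinearMap.norm_adjoint_comp_self (C ∘L V i)
    have h2 : ‖(C ∘L V i).adjoint ∘L (C ∘L V i)‖₊ = ‖C ∘L V i‖₊ ^ 2 :=
      NNReal.eq (by rw [sq]; exact this)
    rw [h2]; push_cast; rfl
  have htr : ∑' k, ‖C (stdBasis E k)‖ₑ ^ 2 ≠ ⊤ := by
    have h1 := Complex.hasSum_re hρ.trace_eq_one
    have h2 : ∀ k, (⟪stdBasis E k, ρ (stdBasis E k)⟫_ℂ).re =
        ((‖C (stdBasis E k)‖₊ ^ 2 : NNReal) : ℝ) := fun k => by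
      rw [← hC, ContinuousLinearMap.comp_apply, ← ContinuousLinearMap.adjoint_inner_left, hCsa,
        inner_self_eq_norm_sq_to_K]
      push_cast
      norm_cast
    simp only [h2] at h1
    have h3 := NNReal.summable_coe.1 h1.summable
    simp only [enorm_eq_nnnorm]
    have := ENNReal.tsum_coe_ne_top_iff_summable.2 h3
    simpa using this
  have hsum : ∑' i, ‖(V i).adjoint ∘L ρ ∘L V i‖ₑ ≤ ∑' k, ‖C (stdBasis E k)‖ₑ ^ 2 := by
    calc ∑' i, ‖(V i).adjoint ∘L ρ ∘L V i‖ₑ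
        ≤ ∑' i, ∑' j, ‖C (V i (b j))‖ₑ ^ 2 := by
          refine ENNReal.tsum_le_tsum fun i => ?_
          rw [hnorm]
          exact enorm_sq_le_tsum b (C ∘L V i)
      _ = ∑' p : ι × κ, ∑' k, ‖⟪stdBasis E k, C (V p.1 (b p.2))⟫_ℂ‖ₑ ^ 2 := by
          rw [← ENNReal.tsum_prod (f := fun i j => ‖C (V i (b j))‖ₑ ^ 2)]
          exact tsum_congr fun p => (tsum_enorm_inner_eq (stdBasis E) _).symm
      _ = ∑' k, ∑' p : ι × κ, ‖⟪V p.1 (b p.2), C (stdBasis E k)⟫_ℂ‖ₑ ^ 2 := by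
          rw [ENNReal.tsum_comm]
          refine tsum_congr fun k => tsum_congr fun p => ?_
          rw [← ContinuousLinearMap.adjoint_inner_left, hCsa, ← inner_conj_symm, RCLike.enorm_conj]
      _ ≤ ∑' k, ‖C (stdBasis E k)‖ₑ ^ 2 :=
          ENNReal.tsum_le_tsum fun k => tsum_enorm_inner_le hV _
  have := ne_top_of_le_ne_top htr hsum
  simp only [enorm_eq_nnnorm] at this
  exact NNReal.summable_coe.2 (ENNReal.tsum_coe_ne_top_iff_summable.1 this)

end Convergence

theorem orthonormal_basis_tmul {S : Type u} {M : Type v}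
    [NormedAddCommGroup S] [InnerProductSpace ℂ S] [NormedAddCommGroup M] [InnerProductSpace ℂ M]
    {ι κ : Type*} {e : ι → S} {f : κ → M}
    (he : Orthonormal ℂ e) (hf : Orthonormal ℂ f) :
    Orthonormal ℂ fun p : ι × κ => ((e p.1 ⊗ₜ[ℂ] f p.2 : S ⊗[ℂ] M) : HTensor S M) :=
  (Orthonormal.tmul he hf).comp_linearIsometry UniformSpace.Completion.toComplₗᵢ

section PartialTraceConvergence

variable {S : Type u} {M : Type v}
  [NormedAddCommGroup S] [InnerProductSpace ℂ S] [CompleteSpace S]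
  [NormedAddCommGroup M] [InnerProductSpace ℂ M] [CompleteSpace M]

/-- The series defining `traceS ρ` converges absolutely in operator norm. -/
theorem summable_traceS {ρ : HTensor S M →L[ℂ] HTensor S M} (hρ : IsDensityOperator ρ) :
    Summable fun i => ‖(tmulLeft (M := M) (stdBasis S i)).adjoint ∘L ρ ∘L
      tmulLeft (stdBasis S i)‖ :=
  hρ.summable_compress (stdBasis M) (fun i => tmulLeft (M := M) (stdBasis S i))
    (orthonormal_basis_tmul (stdBasis S).orthonormal (stdBasis M).orthonormal)

/-- The series defining `traceM ρ` converges absolutely in operator norm. -/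
theorem summable_traceM {ρ : HTensor S M →L[ℂ] HTensor S M} (hρ : IsDensityOperator ρ) :
    Summable fun j => ‖(tmulRight (S := S) (stdBasis M j)).adjoint ∘L ρ ∘L
      tmulRight (stdBasis M j)‖ :=
  hρ.summable_compress (stdBasis S) (fun j => tmulRight (S := S) (stdBasis M j))
    ((orthonormal_basis_tmul (stdBasis S).orthonormal (stdBasis M).orthonormal).comp
      Prod.swap Prod.swap_injective)

end PartialTraceConvergence

/-! ### Sharp observables -/

/-- A sharp observable, given by its spectral decomposition: a projection-valued measure on the
Borel sets of `ℝ`. By the spectral theorem this is the same as a (possibly unbounded) self-adjoint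
operator. If the observable is `∑ λ P_λ`, then `proj B` is the sum of the `P_λ` with `λ ∈ B`; in
particular `proj {λ} = P_λ`. -/
structure SharpObservable (E : Type u) [NormedAddCommGroup E] [InnerProductSpace ℂ E]
    [CompleteSpace E] where
  proj : Set ℝ → E →L[ℂ] E
  isStarProjection : ∀ B, MeasurableSet B → IsStarProjection (proj B)
  proj_univ : proj Set.univ = 1
  proj_inter : ∀ B C, MeasurableSet B → MeasurableSet C → proj (B ∩ C) = proj B ∘L proj C
  hasSum_iUnion : ∀ f : ℕ → Set ℝ, (∀ n, MeasurableSet (f n)) →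
    Pairwise (fun m n => Disjoint (f m) (f n)) →
    ∀ x, HasSum (fun n => proj (f n) x) (proj (⋃ n, f n) x)

/-! ### Hamiltonian and time evolution -/

section Evolution

variable {E : Type u} [NormedAddCommGroup E] [InnerProductSpace ℂ E] [CompleteSpace E]

/-- The densely defined operator `H` is bounded from below. -/
def IsBoundedBelow (H : E →ₗ.[ℂ] E) : Prop :=
  ∃ c : ℝ, ∀ ψ : H.domain, c * ‖(ψ : E)‖ ^ 2 ≤ (⟪(ψ : E), H ψ⟫_ℂ).re

/-- `U t = exp (-(i/ħ) t H)`: the strongly continuous one-parameter unitary group `U` whose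
infinitesimal generator is `-(i/ħ) H`. For self-adjoint `H` there is exactly one such `U`. -/
structure IsEvolution (ħ : ℝ) (H : E →ₗ.[ℂ] E) (U : ℝ → E →L[ℂ] E) : Prop where
  mem_unitary : ∀ t, U t ∈ unitary (E →L[ℂ] E)
  zero : U 0 = 1
  add : ∀ s t, U (s + t) = U s ∘L U t
  continuous : ∀ ψ, Continuous fun t => U t ψ
  schrodinger : ∀ ψ η, HasDerivAt (fun t => U t ψ) η 0 ↔
    ∃ hψ : ψ ∈ H.domain, (Complex.I * (ħ : ℂ)) • η = H ⟨ψ, hψ⟩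

/-- Evolution of an operator by the time `t`: `ρ ↦ U_t ρ U_t†`. -/
def evolve (U : ℝ → E →L[ℂ] E) (t : ℝ) (ρ : E →L[ℂ] E) : E →L[ℂ] E :=
  U t ∘L ρ ∘L (U t).adjoint

end Evolution

/-! ### Accurate measurements and preparations of mixed states -/

section Measurement

variable {S : Type u} {M : Type v}
  [NormedAddCommGroup S] [InnerProductSpace ℂ S] [CompleteSpace S]
  [NormedAddCommGroup M] [InnerProductSpace ℂ M] [CompleteSpace M]

/-- `tr_M ρ = P_B (tr_M ρ) P_B†`: the reduced state of the observed system is a mixture of states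
for which the observable `A` has its value in `B`. -/
def SystemIn (A : SharpObservable S) (B : Set ℝ) (ρ : HTensor S M →L[ℂ] HTensor S M) : Prop :=
  traceM ρ = A.proj B ∘L traceM ρ ∘L (A.proj B).adjoint

/-- `tr_S ρ = Π_B (tr_S ρ) Π_B†`: the reduced state of the pointer is a mixture of states for which
the pointer observable `Z` has its value in `B`. -/
def PointerIn (Z : SharpObservable M) (B : Set ℝ) (ρ : HTensor S M →L[ℂ] HTensor S M) : Prop :=
  traceS ρ = Z.proj B ∘L traceS ρ ∘L (Z.proj B).adjoint

/-- `(I ⊗ Π_B) ρ (I ⊗ Π_B)†`: the (unnormalized) state left by the projection postulate when the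
pointer is found in `B`. -/
def project (Z : SharpObservable M) (B : Set ℝ) (ρ : HTensor S M →L[ℂ] HTensor S M) :
    HTensor S M →L[ℂ] HTensor S M :=
  onPointer (Z.proj B) ∘L ρ ∘L (onPointer (Z.proj B)).adjoint

/-- One run, starting from `ρ₀` at time `0`, of an accurate measurement with result in `B`:
the pointer starts in the ready region `R`, the observed system starts with `A` in `B`, at the time
`T` the total state is supported where the pointer is in `B`, and the pointer stays in `B` during
`(T, T')`. -/
structure AccurateMeasurementRun (U : ℝ → HTensor S M →L[ℂ] HTensor S M)
    (A : SharpObservable S) (Z : SharpObservable M) (R B : Set ℝ) (T T' : ℝ)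
    (ρ₀ : HTensor S M →L[ℂ] HTensor S M) : Prop where
  density : IsDensityOperator ρ₀
  ready : PointerIn Z R ρ₀
  system : SystemIn A B ρ₀
  pointer : evolve U T ρ₀ = project Z B (evolve U T ρ₀)
  persistent : ∀ t ∈ Set.Ioo T T', PointerIn Z B (evolve U t ρ₀)

/-- The device measures accurately whether `A` is in `B`: for every initial state with the pointer
ready, the observed system was initially in `B` if and only if the pointer indicates `B` at the
time `T`, and then the pointer stays in `B` during `(T, T')`. -/
def IsAccurateMeasurement (U : ℝ → HTensor S M →L[ℂ] HTensor S M)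
    (A : SharpObservable S) (Z : SharpObservable M) (R B : Set ℝ) (T T' : ℝ) : Prop :=
  ∀ ρ₀ : HTensor S M →L[ℂ] HTensor S M, IsDensityOperator ρ₀ → PointerIn Z R ρ₀ →
    (SystemIn A B ρ₀ ↔ evolve U T ρ₀ = project Z B (evolve U T ρ₀)) ∧
    (SystemIn A B ρ₀ → ∀ t ∈ Set.Ioo T T', PointerIn Z B (evolve U t ρ₀))

/-- One run, starting from `ρ₀` at time `0`, of an accurate preparation with result in `B`:
the pointer starts in the ready region `R`, at the time `T` the pointer is found in `B` with nonzero
probability, and in the state left by the projection postulate the observed system has `A` in `B`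
and the pointer stays in `B` during `(T, T')`. If `ρ(T)` is already supported where the pointer is
in `B`, then the projection does nothing. -/
structure AccuratePreparationRun (U : ℝ → HTensor S M →L[ℂ] HTensor S M)
    (A : SharpObservable S) (Z : SharpObservable M) (R B : Set ℝ) (T T' : ℝ)
    (ρ₀ : HTensor S M →L[ℂ] HTensor S M) : Prop where
  density : IsDensityOperator ρ₀
  ready : PointerIn Z R ρ₀
  occurs : project Z B (evolve U T ρ₀) ≠ 0
  system : SystemIn A B (project Z B (evolve U T ρ₀))
  persistent : ∀ t ∈ Set.Ioo T T',
    PointerIn Z B (evolve U (t - T) (project Z B (evolve U T ρ₀)))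

/-- The device prepares accurately states with `A` in `B`: the result `B` occurs for some initial
state with the pointer ready, and whenever it occurs, the observed system is left with `A` in `B` at
the time `T` and the pointer stays in `B` during `(T, T')`. -/
def IsAccuratePreparation (U : ℝ → HTensor S M →L[ℂ] HTensor S M)
    (A : SharpObservable S) (Z : SharpObservable M) (R B : Set ℝ) (T T' : ℝ) : Prop :=
  (∃ ρ₀ : HTensor S M →L[ℂ] HTensor S M, IsDensityOperator ρ₀ ∧ PointerIn Z R ρ₀ ∧
    project Z B (evolve U T ρ₀) ≠ 0) ∧
  ∀ ρ₀ : HTensor S M →L[ℂ] HTensor S M, IsDensityOperator ρ₀ → PointerIn Z R ρ₀ →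
    project Z B (evolve U T ρ₀) ≠ 0 →
    SystemIn A B (project Z B (evolve U T ρ₀)) ∧
    ∀ t ∈ Set.Ioo T T', PointerIn Z B (evolve U (t - T) (project Z B (evolve U T ρ₀)))

end Measurement

end QuantumMeasurement

end

/-!
The theorem rests on Hegerfeldt's observation: if the Hamiltonian is bounded from below, then a
projection that a state satisfies during an interval of time is satisfied by it at all times
(`IsEvolution.apply_eq_zero_of_interval`). So a pointer that stays in `B` during `(T, T')` was in
`B` already at the time `0` (`IsEvolution.onPointer_comp_eq_of_interval`), whereas a ready pointer
is in `R`, which is disjoint from `B`. In a measurement run this forces `ρ₀ = 0`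
(`not_accurateMeasurementRun`). In a preparation run it makes `U_T† ρ_B U_T` orthogonal to `ρ₀`,
from which it is obtained, so that `ρ_B² = 0` (`not_accuratePreparationRun`).

Hegerfeldt's observation is usually derived from the spectral theorem, by continuing
`t ↦ ⟪η, U_t φ⟫` analytically to a half-plane. Here only one bounded operator is used, the positive
resolvent `A = (H + m)⁻¹` (`exists_isPositiveResolvent`). If `Q U_t φ = 0` for `|t| < b`, then the
Schrödinger equation makes the bounded holomorphic function `z ↦ Q (H + m + z)⁻¹ φ` on the right
half-plane decay exponentially along the imaginary axis, and it vanishes by a theorem of Carlson's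
type (`eq_zero_of_exp_decay_on_imaginary_axis`). Hence the closed subspace of all such `φ` is
invariant under `A`, and so under every `U_t` (`IsPositiveResolvent.evolution_mem`).

The passage from reduced to total states (`PointerIn.onPointer_comp_eq`) needs the convergence of
the partial traces, also for the unnormalized states after a projection
(`IsDensityOperator.summable_compress_conj`).
-/

namespace QuantumMeasurement

/-! ### A uniqueness theorem on the half-plane -/

open Filter Topology Complex in
/-- A form of Carlson's theorem: a bounded holomorphic function on the right half-plane that decays
exponentially along the imaginary axis vanishes. The factor `exp (-c (z + 1) log (z + 1))` grows
like `exp (c π |y| / 2)` on the imaginary axis and decays superexponentially on the positive real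
axis; with `c π / 2 = β` its product with `g` is still bounded on the imaginary axis, so that the
Phragmén–Lindelöf principle applies to it. -/
theorem eq_zero_of_exp_decay_on_imaginary_axis {F : Type*} [NormedAddCommGroup F] [NormedSpace ℂ F]
    {g : ℂ → F} {β C : ℝ} (hβ : 0 < β) (hd : DiffContOnCl ℂ g {z | 0 < z.re})
    (hb : ∀ z : ℂ, 0 ≤ z.re → ‖g z‖ ≤ C)
    (him : ∀ y : ℝ, ‖g (y * I)‖ ≤ C * Real.exp (-(β * |y|))) :
    ∀ z : ℂ, 0 ≤ z.re → g z = 0 := by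
  set c : ℝ := 2 * β / Real.pi with hc
  have hcpos : 0 < c := by positivity
  have hC : 0 ≤ C := (norm_nonneg _).trans (hb 0 le_rfl)
  set w : ℂ → ℂ := fun z => exp (-(c * ((z + 1) * log (z + 1)))) with hw
  have hslit : ∀ z : ℂ, 0 ≤ z.re → z + 1 ∈ slitPlane := fun z hz =>
    Or.inl (by simp; linarith)
  have hwd : ∀ z : ℂ, 0 ≤ z.re → DifferentiableAt ℂ w z := fun z hz => by
    have h1 : DifferentiableAt ℂ (fun z : ℂ => log (z + 1)) z :=
      (differentiableAt_id.add_const 1).clog (hslit z hz)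
    exact ((((differentiableAt_id.add_const 1).mul h1).const_mul (c : ℂ)).neg).cexp
  have hcl : closure {z : ℂ | 0 < z.re} = {z | 0 ≤ z.re} := closure_setOfPred_lt_re 0
  have hwdc : DiffContOnCl ℂ w {z | 0 < z.re} :=
    ⟨fun z hz => (hwd z (le_of_lt hz)).differentiableWithinAt,
      fun z hz => (hwd z (by rw [hcl] at hz; exact hz)).continuousAt.continuousWithinAt⟩
  have hwn : ∀ z : ℂ, 0 ≤ z.re → ‖w z‖ ≤ Real.exp (β * |z.im|) := fun z hz => by
    have h1 : (1 : ℝ) ≤ ‖z + 1‖ := by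
      refine le_trans ?_ (re_le_norm _)
      simp; linarith
    have h2 : |arg (z + 1)| ≤ Real.pi / 2 := by
      rw [abs_arg_le_pi_div_two_iff]; simp; linarith
    have h3 : z.im * arg (z + 1) ≤ |z.im| * (Real.pi / 2) := by
      refine (le_abs_self _).trans ?_
      rw [abs_mul]; gcongr
    have h4 : 0 ≤ (z.re + 1) * Real.log ‖z + 1‖ := mul_nonneg (by linarith) (Real.log_nonneg h1)
    have h5 : c * (|z.im| * (Real.pi / 2)) = β * |z.im| := by
      rw [hc]; field_simp
    rw [hw, norm_exp]
    refine Real.exp_le_exp.2 ?_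
    simp only [neg_re, mul_re, ofReal_re, ofReal_im, zero_mul, sub_zero, add_re, one_re,
      add_im, one_im, add_zero, log_re, log_im]
    rw [← h5]
    nlinarith [mul_le_mul_of_nonneg_left h3 hcpos.le, mul_nonneg hcpos.le h4]
  have hzero := PhragmenLindelof.eq_zero_on_right_half_plane_of_superexponential_decay
    (f := fun z => w z • g z) (hwdc.smul hd) ?_ ?_ ?_
  · intro z hz
    have h := hzero (show z ∈ {z : ℂ | 0 ≤ z.re} from hz)
    exact (smul_eq_zero.1 h).resolve_left (exp_ne_zero _)
  · refine ⟨1, by norm_num, β, Asymptotics.IsBigO.of_bound C ?_⟩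
    refine (eventually_inf_principal.2 (Eventually.of_forall fun z hz => ?_))
    have hz' : 0 ≤ z.re := le_of_lt hz
    rw [norm_smul, Real.rpow_one, Real.norm_of_nonneg (Real.exp_pos _).le, mul_comm]
    refine mul_le_mul (hb z hz') ((hwn z hz').trans ?_) (norm_nonneg _) hC
    gcongr
    exact abs_im_le_norm z
  · intro n
    have hlim : Tendsto (fun x : ℝ => C * Real.exp (-x)) atTop (𝓝 0) := by
      simpa using (Real.tendsto_exp_neg_atTop_nhds_zero).const_mul C
    refine squeeze_zero' (Eventually.of_forall fun x => by positivity) ?_ hlim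
    have hlog : ∀ᶠ x : ℝ in atTop, (n + 1 : ℝ) / c ≤ Real.log (x + 1) :=
      (Real.tendsto_log_atTop.comp
        (tendsto_atTop_add_const_right _ 1 tendsto_id)).eventually_ge_atTop _
    filter_upwards [hlog, eventually_ge_atTop 0] with x hx hx0
    have h1 : w x = ((Real.exp (-(c * ((x + 1) * Real.log (x + 1)))) : ℝ) : ℂ) := by
      rw [hw]
      push_cast [ofReal_log (by linarith : 0 ≤ x + 1)]
      rfl
    rw [norm_smul, h1, norm_real, Real.norm_of_nonneg (Real.exp_pos _).le, ← Real.exp_nat_mul]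
    have h2 : (n + 1 : ℝ) ≤ c * Real.log (x + 1) := by
      rw [div_le_iff₀ hcpos] at hx; linarith
    have h3 : (n : ℝ) * x + -(c * ((x + 1) * Real.log (x + 1))) ≤ -x := by
      nlinarith [mul_le_mul_of_nonneg_left h2 (by linarith : 0 ≤ x + 1),
        (Nat.cast_nonneg n : (0 : ℝ) ≤ n)]
    calc Real.exp (n * x) * (Real.exp (-(c * ((x + 1) * Real.log (x + 1)))) * ‖g x‖)
        = Real.exp (n * x + -(c * ((x + 1) * Real.log (x + 1)))) * ‖g x‖ := by
          rw [Real.exp_add]; ring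
      _ ≤ Real.exp (-x) * C :=
          mul_le_mul (Real.exp_le_exp.2 h3) (hb _ (by simpa using hx0)) (norm_nonneg _)
            (Real.exp_pos _).le
      _ = C * Real.exp (-x) := mul_comm _ _
  · refine ⟨C, fun y => ?_⟩
    have h1 := hwn (y * I) (by simp)
    have h2 : ((y : ℂ) * I).im = y := by simp
    rw [h2] at h1
    rw [norm_smul]
    calc ‖w (y * I)‖ * ‖g (y * I)‖
        ≤ Real.exp (β * |y|) * (C * Real.exp (-(β * |y|))) :=
          mul_le_mul h1 (him y) (norm_nonneg _) (Real.exp_pos _).le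
      _ = C := by rw [mul_left_comm, ← Real.exp_add]; simp

/-! ### The operators `1 + z A` for a positive operator `A` -/

section PositiveInverse
variable {E : Type*} [NormedAddCommGroup E] [InnerProductSpace ℂ E]

theorem norm_sq_le_re_inner_one_add_smul {A : E →L[ℂ] E} (hA : A.IsPositive) {z : ℂ} (hz : 0 ≤ z.re)
    (x : E) : ‖x‖ ^ 2 ≤ (⟪x, (1 + z • A) x⟫_ℂ).re := by
  obtain ⟨h1, h2⟩ := Complex.nonneg_iff.1 (hA.inner_nonneg_right x)
  have h3 : (⟪x, x⟫_ℂ).re = ‖x‖ ^ 2 := inner_self_eq_norm_sq (𝕜 := ℂ) x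
  rw [add_apply, smul_apply, inner_add_right,
    inner_smul_right, Complex.add_re, Complex.mul_re, ← h2, one_apply_eq_self, h3]
  nlinarith [mul_nonneg hz h1]

theorem isUnit_one_add_smul [CompleteSpace E] {A : E →L[ℂ] E} (hA : A.IsPositive) {z : ℂ}
    (hz : 0 ≤ z.re) :
    IsUnit (1 + z • A) := by
  refine ContinuousLinearMap.isUnit_of_forall_le_norm_inner_map _ (c := 1) one_pos fun x => ?_
  rw [norm_inner_symm, NNReal.coe_one, mul_one]
  exact (norm_sq_le_re_inner_one_add_smul hA hz x).trans (Complex.re_le_norm _)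

theorem norm_inverse_one_add_smul_le [CompleteSpace E] {A : E →L[ℂ] E} (hA : A.IsPositive)
    {z : ℂ} (hz : 0 ≤ z.re) :
    ‖Ring.inverse (1 + z • A)‖ ≤ 1 := by
  refine ContinuousLinearMap.opNorm_le_bound _ zero_le_one fun x => ?_
  set y := Ring.inverse (1 + z • A) x with hy
  have h1 : (1 + z • A) y = x := by
    have := Ring.mul_inverse_cancel _ (isUnit_one_add_smul hA hz)
    exact DFunLike.congr_fun this x
  have h2 := norm_sq_le_re_inner_one_add_smul hA hz y
  rw [h1] at h2
  have h3 : ‖y‖ ^ 2 ≤ ‖y‖ * ‖x‖ :=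
    h2.trans ((Complex.re_le_norm _).trans (norm_inner_le_norm _ _))
  rw [one_mul]
  by_contra! h
  have h4 : 0 < ‖y‖ := (norm_nonneg x).trans_lt h
  nlinarith

end PositiveInverse

/-! ### The resolvent of the Hamiltonian -/

section Resolvent
variable {E : Type*} [NormedAddCommGroup E] [InnerProductSpace ℂ E] [CompleteSpace E]

/-- The bounded operator `A` is positive and equal to `(H + m)⁻¹`. The inverse is expressed through
the graph of `H`: `H (A w) = w - m A w` for every `w`, and `A (H x + m x) = x` for every `x` in the
domain of `H`. -/
structure IsPositiveResolvent (H : E →ₗ.[ℂ] E) (m : ℝ) (A : E →L[ℂ] E) : Prop where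
  isPositive : A.IsPositive
  mem_graph : ∀ w, (A w, w - (m : ℂ) • A w) ∈ H.graph
  apply_of_mem_graph : ∀ x y, (x, y) ∈ H.graph → A (y + (m : ℂ) • x) = x

/-- If `H ≥ c`, then `H + m ≥ 1` for `m = 1 - c`. Hence `(x, H x) ↦ H x + m x` is bounded below on
the graph of `H`, which is complete, and its range is closed; the range is dense because a vector
orthogonal to it lies in the domain of the adjoint `H† = H` and in the kernel of `H + m`. -/
theorem exists_isPositiveResolvent {H : E →ₗ.[ℂ] E} (hH : IsSelfAdjoint H)
    (hbelow : IsBoundedBelow H) : ∃ m A, IsPositiveResolvent H m A := by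
  obtain ⟨c, hc⟩ := hbelow
  have hdense := hH.dense_domain
  have hadj : H.adjoint = H := hH
  have hsymm : ∀ x y : H.domain, ⟪H x, (y : E)⟫_ℂ = ⟪(x : E), H y⟫_ℂ := by
    have h := LinearPMap.adjoint_isFormalAdjoint hdense
    rw [hadj] at h
    exact h
  set m : ℝ := 1 - c with hm
  have hlow : ∀ x y, (x, y) ∈ H.graph → ‖x‖ ^ 2 ≤ (⟪x, y + (m : ℂ) • x⟫_ℂ).re := by
    intro x y hxy
    obtain ⟨ψ, h1, h2⟩ := (LinearPMap.mem_graph_iff _).1 hxy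
    simp only at h1 h2
    subst h1 h2
    have h3 : (⟪(ψ : E), (ψ : E)⟫_ℂ).re = ‖(ψ : E)‖ ^ 2 := inner_self_eq_norm_sq (𝕜 := ℂ) _
    rw [inner_add_right, inner_smul_right, Complex.add_re, Complex.re_ofReal_mul, h3, hm]
    linarith [hc ψ]
  have hnorm : ∀ x y, (x, y) ∈ H.graph → ‖x‖ ≤ ‖y + (m : ℂ) • x‖ := by
    intro x y hxy
    have h1 : ‖x‖ ^ 2 ≤ ‖x‖ * ‖y + (m : ℂ) • x‖ :=
      (hlow x y hxy).trans ((Complex.re_le_norm _).trans (norm_inner_le_norm _ _))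
    by_contra! h
    have h4 : 0 < ‖x‖ := (norm_nonneg _).trans_lt h
    nlinarith
  have : CompleteSpace H.graph := hH.isClosed.completeSpace_coe
  let L : H.graph →L[ℂ] E := (ContinuousLinearMap.snd ℂ E E +
    (m : ℂ) • ContinuousLinearMap.fst ℂ E E) ∘L H.graph.subtypeL
  have hL : ∀ p : H.graph, L p = p.1.2 + (m : ℂ) • p.1.1 := fun p => rfl
  have hanti : ∀ p : H.graph, ‖p‖ ≤ (1 + |m| : ℝ) * ‖L p‖ := by
    intro p
    have h1 := hnorm p.1.1 p.1.2 p.2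
    rw [← hL] at h1
    have h2 : ‖p.1.2‖ ≤ ‖L p‖ + |m| * ‖p.1.1‖ := by
      have : p.1.2 = L p - (m : ℂ) • p.1.1 := by rw [hL]; abel
      rw [this]
      refine (norm_sub_le _ _).trans (le_of_eq ?_)
      rw [norm_smul, Complex.norm_real, Real.norm_eq_abs]
    have h3 : |m| * ‖p.1.1‖ ≤ |m| * ‖L p‖ := by gcongr
    have h4 : 0 ≤ |m| * ‖L p‖ := by positivity
    rw [add_mul, one_mul]
    exact max_le (show ‖p.1.1‖ ≤ _ by linarith) (show ‖p.1.2‖ ≤ _ by linarith)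
  have hker : L.ker = ⊥ := by
    refine LinearMap.ker_eq_bot'.2 fun p hp => ?_
    have h1 := hanti p
    have hp' : L p = 0 := hp
    rw [hp', norm_zero, mul_zero] at h1
    exact norm_le_zero_iff.1 h1
  have hclosed : IsClosed (Set.range L) := by
    have : AntilipschitzWith (Real.toNNReal (1 + |m|)) L :=
      L.antilipschitz_of_bound fun p => by
        rw [Real.coe_toNNReal _ (by positivity)]; exact hanti p
    exact this.isClosed_range L.uniformContinuous
  have hrange : L.range = ⊤ := by
    have : CompleteSpace L.range := IsClosed.isComplete hclosed |>.completeSpace_coe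
    refine (Submodule.orthogonal_eq_bot_iff).1 ((Submodule.eq_bot_iff _).2 fun y hy => ?_)
    have h1 : ∀ x : H.domain, ⟪(-(m : ℂ)) • y, (x : E)⟫_ℂ = ⟪y, H x⟫_ℂ := by
      intro x
      have h := (Submodule.mem_orthogonal' _ _).1 hy
        (L ⟨((x : E), H x), (LinearPMap.mem_graph_iff _).2 ⟨x, rfl, rfl⟩⟩) ⟨_, rfl⟩
      rw [hL] at h
      simp only [inner_add_right, inner_smul_right] at h
      rw [inner_smul_left, map_neg, Complex.conj_ofReal]
      linear_combination -h
    have hy1 : y ∈ H.adjoint.domain := LinearPMap.mem_adjoint_domain_of_exists y ⟨_, h1⟩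
    have hy2 : H.adjoint ⟨y, hy1⟩ = -(m : ℂ) • y := LinearPMap.adjoint_apply_eq hdense _ h1
    have hg : (y, -(m : ℂ) • y) ∈ H.adjoint.graph :=
      (LinearPMap.mem_graph_iff _).2 ⟨⟨y, hy1⟩, rfl, hy2⟩
    rw [hadj] at hg
    have := hnorm _ _ hg
    rw [neg_smul, neg_add_cancel, norm_zero] at this
    exact norm_le_zero_iff.1 this
  let e := ContinuousLinearEquiv.ofBijective L hker hrange
  let A : E →L[ℂ] E :=
    ContinuousLinearMap.fst ℂ E E ∘L H.graph.subtypeL ∘L (e.symm : E →L[ℂ] H.graph)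
  have hA : ∀ w, (A w, w - (m : ℂ) • A w) ∈ H.graph := by
    intro w
    have h1 : L (e.symm w) = w := ContinuousLinearEquiv.ofBijective_apply_symm_apply L hker hrange w
    have h2 : (A w, w - (m : ℂ) • A w) = ((e.symm w : H.graph) : E × E) := by
      refine Prod.ext rfl ?_
      rw [hL] at h1
      exact sub_eq_of_eq_add h1.symm
    rw [h2]; exact (e.symm w).2
  have hAsymm : ∀ v w, ⟪A v, w⟫_ℂ = ⟪v, A w⟫_ℂ := by
    intro v w
    obtain ⟨x, hx1, hx2⟩ := (LinearPMap.mem_graph_iff _).1 (hA v)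
    obtain ⟨y, hy1, hy2⟩ := (LinearPMap.mem_graph_iff _).1 (hA w)
    have h := hsymm x y
    simp only at hx1 hx2 hy1 hy2
    rw [hx1, hx2, hy1, hy2] at h
    simp only [inner_sub_left, inner_sub_right, inner_smul_left, inner_smul_right,
      Complex.conj_ofReal] at h
    linear_combination -h
  refine ⟨m, A, ⟨ContinuousLinearMap.isPositive_def.2 ⟨hAsymm, fun w => ?_⟩, hA, ?_⟩⟩
  · have h1 := hlow _ _ (hA w)
    rw [sub_add_cancel] at h1
    change 0 ≤ (⟪A w, w⟫_ℂ).re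
    rw [hAsymm, ← inner_conj_symm, Complex.conj_re]
    exact (sq_nonneg _).trans h1
  · intro x y hxy
    have h := ContinuousLinearEquiv.ofBijective_symm_apply_apply L hker hrange ⟨(x, y), hxy⟩
    exact congrArg (fun p : H.graph => p.1.1) h

variable {ħ m : ℝ} {H : E →ₗ.[ℂ] E} {U : ℝ → E →L[ℂ] E} {A : E →L[ℂ] E}

theorem IsEvolution.norm_apply (hU : IsEvolution ħ H U) (t : ℝ) (x : E) : ‖U t x‖ = ‖x‖ :=
  ContinuousLinearMap.norm_map_of_mem_unitary (hU.mem_unitary t) x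

theorem IsEvolution.add_apply (hU : IsEvolution ħ H U) (s t : ℝ) (x : E) :
    U (s + t) x = U s (U t x) := by rw [hU.add]; rfl

theorem IsEvolution.hasDerivAt_of_zero (hU : IsEvolution ħ H U) {x η : E}
    (h : HasDerivAt (fun t => U t x) η 0) (t : ℝ) : HasDerivAt (fun t => U t x) (U t η) t := by
  have h1 : HasDerivAt (fun s => U (s - t) x) η t := by
    have := h
    rw [← sub_self t] at this
    exact this.comp_sub_const t t
  have h2 := ((U t).restrictScalars ℝ).hasFDerivAt.comp_hasDerivAt t h1
  refine h2.congr_of_eventuallyEq (Filter.Eventually.of_forall fun s => ?_)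
  change U s x = U t (U (s - t) x)
  rw [← hU.add_apply, add_sub_cancel]

/-- The Schrödinger equation, as a description of the graph of `H`. -/
theorem IsEvolution.mem_graph_iff (hħ : 0 < ħ) (hU : IsEvolution ħ H U) (x y : E) :
    (x, y) ∈ H.graph ↔ HasDerivAt (fun t => U t x) (-(Complex.I / ħ) • y) 0 := by
  have h0 : (ħ : ℂ) ≠ 0 := by exact_mod_cast hħ.ne'
  have h1 : (Complex.I * (ħ : ℂ)) • (-(Complex.I / ħ) • y) = y := by
    rw [smul_smul]
    have : Complex.I * (ħ : ℂ) * -(Complex.I / ħ) = 1 := by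
      field_simp; simp
    rw [this, one_smul]
  rw [hU.schrodinger, h1, LinearPMap.mem_graph_iff]
  constructor
  · rintro ⟨ψ, h2, h3⟩
    simp only at h2 h3
    subst h2 h3
    exact ⟨ψ.2, rfl⟩
  · rintro ⟨h2, h3⟩
    exact ⟨⟨x, h2⟩, rfl, h3.symm⟩

theorem IsPositiveResolvent.hasDerivAt (hA : IsPositiveResolvent H m A) (hħ : 0 < ħ)
    (hU : IsEvolution ħ H U) (w : E) (t : ℝ) :
    HasDerivAt (fun t => U t (A w)) (-(Complex.I / ħ) • U t (w - (m : ℂ) • A w)) t := by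
  have := hU.hasDerivAt_of_zero ((hU.mem_graph_iff hħ _ _).1 (hA.mem_graph w)) t
  rwa [map_smul] at this

theorem IsPositiveResolvent.commute (hA : IsPositiveResolvent H m A) (hħ : 0 < ħ)
    (hU : IsEvolution ħ H U) (t : ℝ) (w : E) : A (U t w) = U t (A w) := by
  have h1 : (U t (A w), U t (w - (m : ℂ) • A w)) ∈ H.graph := by
    rw [hU.mem_graph_iff hħ]
    have h2 := (hU.mem_graph_iff hħ _ _).1 (hA.mem_graph w)
    have h3 := ((U t).restrictScalars ℝ).hasFDerivAt.comp_hasDerivAt 0 h2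
    have h4 : (U t) (-(Complex.I / ħ) • (w - (m : ℂ) • A w)) =
        -(Complex.I / ħ) • (U t) (w - (m : ℂ) • A w) := map_smul _ _ _
    rw [← h4]
    refine h3.congr_of_eventuallyEq (Filter.Eventually.of_forall fun s => ?_)
    change U s (U t (A w)) = U t (U s (A w))
    rw [← hU.add_apply, ← hU.add_apply, add_comm]
  have h2 := hA.apply_of_mem_graph _ _ h1
  rwa [← map_smul (U t), ← map_add (U t), sub_add_cancel] at h2

omit [CompleteSpace E] in
theorem IsPositiveResolvent.injective (hA : IsPositiveResolvent H m A) {w : E} (h : A w = 0) :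
    w = 0 := by
  have h1 := hA.mem_graph w
  rw [h, smul_zero, sub_zero] at h1
  exact LinearPMap.graph_fst_eq_zero_snd _ h1 rfl

end Resolvent

/-! ### Spectral bounds and vanishing on an interval -/

section Hegerfeldt
variable {E : Type*} [NormedAddCommGroup E] [InnerProductSpace ℂ E] [CompleteSpace E]
variable {F : Type*} [NormedAddCommGroup F] [NormedSpace ℂ F]
variable {ħ m : ℝ} {H : E →ₗ.[ℂ] E} {U : ℝ → E →L[ℂ] E} {A : E →L[ℂ] E}

/-- The vector `ψ = A w = (H + m + z)⁻¹ φ` satisfies `H ψ = φ - (z + m) ψ`, so `U_t ψ` solves a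
linear differential equation with the inhomogeneous term `-(i/ħ) U_t φ`. Where `Q` annihilates this
term, `Q U_t ψ` is an exponential. -/
theorem IsPositiveResolvent.apply_evolution_eq (hA : IsPositiveResolvent H m A) (hħ : 0 < ħ)
    (hU : IsEvolution ħ H U) (Q : E →L[ℂ] F) {b : ℝ} {φ : E}
    (hφ : ∀ t ∈ Set.Ioo (-b) b, Q (U t φ) = 0) {z : ℂ} {w : E} (hw : w + z • A w = φ)
    {t : ℝ} (ht : t ∈ Set.Ioo (-b) b) :
    Q (U t (A w)) = Complex.exp (Complex.I / ħ * (z + m) * t) • Q (A w) := by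
  have hb : (0 : ℝ) ∈ Set.Ioo (-b) b := ⟨by linarith [ht.1, ht.2], by linarith [ht.1, ht.2]⟩
  set κ : ℂ := Complex.I / ħ * (z + m) with hκ
  set g : ℝ → F := fun t => Complex.exp (-(κ * t)) • Q (U t (A w)) with hg
  have hder : ∀ t ∈ Set.Ioo (-b) b, HasDerivAt g 0 t := by
    intro t ht
    have h1 := (Q.restrictScalars ℝ).hasFDerivAt.comp_hasDerivAt t (hA.hasDerivAt hħ hU w t)
    have h2 : HasDerivAt (fun t : ℝ => Complex.exp (-(κ * t))) (Complex.exp (-(κ * t)) * -κ) t := by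
      have h3 : HasDerivAt (fun t : ℝ => -(κ * (t : ℂ))) (-κ) t := by
        exact ((Complex.ofRealCLM.hasDerivAt (x := t)).const_mul κ).neg.congr_deriv (by simp)
      exact h3.cexp
    have h4 : HasDerivAt g _ t := h2.smul h1
    refine h4.congr_deriv ?_
    have h5 : w = φ - z • A w := eq_sub_of_add_eq hw
    have h6 : Q (U t (w - (m : ℂ) • A w)) = -((z + m) • Q (U t (A w))) := by
      have h7 : w - (m : ℂ) • A w = φ - (z + m) • A w := by
        rw [add_smul]; nth_rewrite 1 [h5]; abel
      rw [h7, map_sub, map_sub, hφ t ht, map_smul, map_smul, zero_sub]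
    change Complex.exp (-(κ * t)) • Q (-(Complex.I / ħ) • U t (w - (m : ℂ) • A w)) +
      (Complex.exp (-(κ * t)) * -κ) • Q (U t (A w)) = 0
    rw [map_smul, h6, hκ]
    module
  have hconst : g t = g 0 :=
    isOpen_Ioo.is_const_of_deriv_eq_zero isPreconnected_Ioo
      (fun s hs => (hder s hs).differentiableAt.differentiableWithinAt)
      (fun s hs => (hder s hs).deriv) ht hb
  have h0 : g 0 = Q (A w) := by simp [hg, hU.zero]
  rw [h0] at hconst
  rw [← hconst, hg, smul_smul, ← Complex.exp_add, add_neg_cancel, Complex.exp_zero, one_smul]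

/-- The place where it matters that `H` is bounded from below: the function
`z ↦ Q (H + m + z)⁻¹ φ = Q A (1 + z A)⁻¹ φ` is bounded and holomorphic on the right half-plane, and
if `Q U_t φ` vanishes for `|t| < b` then it decays exponentially on the imaginary axis. -/
theorem IsPositiveResolvent.apply_resolvent_eq_zero (hA : IsPositiveResolvent H m A) (hħ : 0 < ħ)
    (hU : IsEvolution ħ H U) (Q : E →L[ℂ] F) {b : ℝ} (hb : 0 < b) {φ : E}
    (hφ : ∀ t ∈ Set.Ioo (-b) b, Q (U t φ) = 0) : Q (A φ) = 0 := by
  set r : ℂ → E →L[ℂ] E := fun z => Ring.inverse (1 + z • A) with hr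
  have hrw : ∀ z : ℂ, 0 ≤ z.re → r z φ + z • A (r z φ) = φ := fun z hz =>
    DFunLike.congr_fun (Ring.mul_inverse_cancel _ (isUnit_one_add_smul hA.isPositive hz)) φ
  have hrn : ∀ z : ℂ, 0 ≤ z.re → ‖r z φ‖ ≤ ‖φ‖ := fun z hz => by
    simpa using (r z).le_of_opNorm_le (norm_inverse_one_add_smul_le hA.isPositive hz) φ
  have hrd : ∀ z : ℂ, 0 ≤ z.re → DifferentiableAt ℂ (fun z => Q (A (r z φ))) z := fun z hz => by
    have h1 : DifferentiableAt ℂ r z :=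
      ((differentiableAt_id.smul_const A).const_add 1).inverse
        (isUnit_one_add_smul hA.isPositive hz)
    exact (Q ∘L A).differentiableAt.comp z (h1.clm_apply (differentiableAt_const φ))
  have hbound : ∀ x : E, ‖x‖ ≤ ‖A‖ * ‖φ‖ → ‖Q x‖ ≤ ‖Q‖ * (‖A‖ * ‖φ‖) := fun x hx =>
    Q.le_opNorm_of_le hx
  have hAr : ∀ z : ℂ, 0 ≤ z.re → ‖A (r z φ)‖ ≤ ‖A‖ * ‖φ‖ := fun z hz =>
    A.le_opNorm_of_le (hrn z hz)
  have key := eq_zero_of_exp_decay_on_imaginary_axis (g := fun z => Q (A (r z φ)))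
    (β := b / (2 * ħ)) (C := ‖Q‖ * (‖A‖ * ‖φ‖))
    (by positivity)
    ⟨fun z hz => (hrd z (le_of_lt hz)).differentiableWithinAt, fun z hz =>
      (hrd z (by rw [Complex.closure_setOfPred_lt_re] at hz; exact
        hz)).continuousAt.continuousWithinAt⟩
    (fun z hz => hbound _ (hAr z hz)) ?_ 0 le_rfl
  · simpa [hr] using key
  intro y
  have hz : 0 ≤ ((y : ℂ) * Complex.I).re := by simp
  -- `|Q U_t A w| = exp (-y t / ħ) |Q A w|` for `z = i y`; the sign of `t` is chosen to make the
  -- exponential large.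
  obtain ⟨t, ht, hty⟩ : ∃ t ∈ Set.Ioo (-b) b, y * t = -(|y| * (b / 2)) := by
    rcases le_total 0 y with h | h
    · exact ⟨-(b / 2), ⟨by linarith, by linarith⟩, by rw [abs_of_nonneg h]; ring⟩
    · exact ⟨b / 2, ⟨by linarith, by linarith⟩, by rw [abs_of_nonpos h]; ring⟩
  have h1 := congrArg norm (hA.apply_evolution_eq hħ hU Q hφ (hrw _ hz) ht)
  have h2 : (Complex.I / ħ * (y * Complex.I + m) * t).re = b / (2 * ħ) * |y| := by
    have h3 : Complex.I / ħ * (y * Complex.I + m) * t =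
        ((-(y * t / ħ) : ℝ) : ℂ) + ((m * t / ħ : ℝ) : ℂ) * Complex.I := by
      have h0 : (ħ : ℂ) ≠ 0 := by exact_mod_cast hħ.ne'
      push_cast
      field_simp
      linear_combination (t * y : ℂ) * Complex.I_sq
    rw [h3, hty]
    simp
    field_simp
  rw [norm_smul, Complex.norm_exp, h2] at h1
  have h4 := hbound _ ((hU.norm_apply t _).trans_le (hAr _ hz))
  rw [Real.exp_neg, ← div_eq_mul_inv, le_div_iff₀ (Real.exp_pos _), mul_comm]
  exact h1 ▸ h4

/-- A closed subspace invariant under the resolvent is invariant under the evolution: the projection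
`P` onto its orthogonal complement commutes with `A`, so for `φ` in the subspace `v t = P U_t A φ`
solves the Schrödinger equation with `v 0 = 0`, and the norm of a solution is conserved. -/
theorem IsPositiveResolvent.evolution_mem (hA : IsPositiveResolvent H m A) (hħ : 0 < ħ)
    (hU : IsEvolution ħ H U) (N : Submodule ℂ E) (hN : IsClosed (N : Set E))
    (hAN : ∀ x ∈ N, A x ∈ N) {φ : E} (hφ : φ ∈ N) (t : ℝ) : U t φ ∈ N := by
  have : CompleteSpace N := hN.completeSpace_coe
  set P : E →L[ℂ] E := Nᗮ.starProjection with hP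
  have hAN' : ∀ x ∈ Nᗮ, A x ∈ Nᗮ := fun x hx => (Submodule.mem_orthogonal _ _).2 fun u hu => by
    rw [← hA.isPositive.inner_left_eq_inner_right]
    exact (Submodule.mem_orthogonal _ _).1 hx _ (hAN u hu)
  have hPN : ∀ x ∈ N, P x = 0 := fun x hx => by
    rw [hP, Submodule.starProjection_apply_eq_zero_iff, Submodule.orthogonal_orthogonal]
    exact hx
  have hPA : ∀ x, P (A x) = A (P x) := fun x => by
    have h1 : x - P x ∈ N := by
      have := Submodule.sub_starProjection_mem_orthogonal (K := Nᗮ) x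
      rwa [Submodule.orthogonal_orthogonal] at this
    have h2 : A x = A (x - P x) + A (P x) := by rw [← map_add, sub_add_cancel]
    rw [h2, map_add, hPN _ (hAN _ h1), zero_add]
    exact Submodule.starProjection_eq_self_iff.2 (hAN' _ (Submodule.starProjection_apply_mem _ _))
  set v : ℝ → E := fun t => P (U t (A φ)) with hv
  have hvA : ∀ t, v t = A (P (U t φ)) := fun t => by
    rw [hv, ← hPA, hA.commute hħ hU]
  have hder : ∀ t, HasDerivAt (fun t => ⟪v t, v t⟫_ℂ) 0 t := fun t => by
    have h1 := (P.restrictScalars ℝ).hasFDerivAt.comp_hasDerivAt t (hA.hasDerivAt hħ hU φ t)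
    have h2 : HasDerivAt v (-(Complex.I / ħ) • (P (U t φ) - (m : ℂ) • v t)) t := by
      refine HasDerivAt.congr_deriv (f := v) h1 ?_
      change P (-(Complex.I / ħ) • U t (φ - (m : ℂ) • A φ)) = _
      simp only [map_smul, map_sub, hv]
    refine (h2.inner ℂ h2).congr_deriv ?_
    have h3 : (⟪v t, P (U t φ) - (m : ℂ) • v t⟫_ℂ).im = 0 := by
      have h4 := (Complex.nonneg_iff.1 (hA.isPositive.inner_nonneg_left (P (U t φ)))).2
      have h5 : (⟪v t, v t⟫_ℂ).im = 0 := inner_self_im (𝕜 := ℂ) _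
      rw [← hvA] at h4
      rw [inner_sub_right, inner_smul_right, Complex.sub_im, Complex.im_ofReal_mul, h5, ← h4]
      simp
    have h6 := Complex.conj_eq_iff_im.2 h3
    rw [inner_conj_symm] at h6
    rw [inner_smul_left, inner_smul_right, h6, map_neg, map_div₀, Complex.conj_I,
      Complex.conj_ofReal]
    ring
  have hv0 : v t = 0 := by
    have h1 := is_const_of_deriv_eq_zero (fun s => (hder s).differentiableAt)
      (fun s => (hder s).deriv) t 0
    have h2 : v 0 = 0 := by
      rw [hv]
      simp only [hU.zero]
      exact hPN _ (hAN _ hφ)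
    simpa [h2] using h1
  rw [hvA] at hv0
  have h1 := hA.injective hv0
  rwa [hP, Submodule.starProjection_apply_eq_zero_iff, Submodule.orthogonal_orthogonal] at h1

/-- Hegerfeldt's theorem: for a Hamiltonian bounded from below, if `Q U_t φ` vanishes for `t` in an
interval, then it vanishes for all `t`. -/
theorem IsEvolution.apply_eq_zero_of_interval (hħ : 0 < ħ) (hH : IsSelfAdjoint H)
    (hbelow : IsBoundedBelow H) (hU : IsEvolution ħ H U) (Q : E →L[ℂ] F) {a b : ℝ} (hab : a < b)
    {φ : E} (hφ : ∀ t ∈ Set.Ioo a b, Q (U t φ) = 0) (t : ℝ) : Q (U t φ) = 0 := by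
  obtain ⟨m, A, hA⟩ := exists_isPositiveResolvent hH hbelow
  set c := (a + b) / 2 with hc
  set d := (b - a) / 2 with hd
  have hd0 : 0 < d := by rw [hd]; linarith
  -- The subspace of the vectors that `Q` does not see during the interval, centred at `0`.
  let N : Submodule ℂ E := ⨅ s ∈ Set.Ioo (-d) d, (Q ∘L U s).ker
  have hmem : ∀ x, x ∈ N ↔ ∀ s ∈ Set.Ioo (-d) d, Q (U s x) = 0 := fun x => by
    simp [N, Submodule.mem_iInf]
  have hclosed : IsClosed (N : Set E) := by
    simp only [N, Submodule.coe_iInf]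
    exact isClosed_iInter fun s => isClosed_iInter fun _ => (Q ∘L U s).isClosed_ker
  have hAN : ∀ x ∈ N, A x ∈ N := fun x hx => by
    rw [hmem] at hx ⊢
    intro s hs
    have h0 : x + (0 : ℂ) • A x = x := by simp
    rw [hA.apply_evolution_eq hħ hU Q hx h0 hs, hA.apply_resolvent_eq_zero hħ hU Q hd0 hx,
      smul_zero]
  have hφN : U c φ ∈ N := (hmem _).2 fun s hs => by
    rw [← hU.add_apply]
    exact hφ _ ⟨by linarith [hs.1], by linarith [hs.2]⟩
  have h1 := (hmem _).1 (hA.evolution_mem hħ hU N hclosed hAN hφN (t - c)) 0 ⟨by linarith, hd0⟩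
  rwa [← hU.add_apply, ← hU.add_apply, zero_add, sub_add_cancel] at h1

end Hegerfeldt

/-! ### Positive operators and density operators -/

section Positive
variable {E : Type*} [NormedAddCommGroup E] [InnerProductSpace ℂ E] [CompleteSpace E]

theorem exists_selfAdjoint_sqrt {ρ : E →L[ℂ] E} (hρ : ρ.IsPositive) :
    ∃ C : E →L[ℂ] E, C.adjoint = C ∧ C ∘L C = ρ :=
  ⟨CFC.sqrt ρ, (CFC.sqrt_nonneg ρ).isSelfAdjoint,
    CFC.sqrt_mul_sqrt_self ρ ((ContinuousLinearMap.nonneg_iff_isPositive ρ).2 hρ)⟩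

theorem apply_eq_zero_of_inner_eq_zero {ρ : E →L[ℂ] E} (hρ : ρ.IsPositive) {x : E}
    (hx : ⟪x, ρ x⟫_ℂ = 0) : ρ x = 0 := by
  obtain ⟨C, hC, rfl⟩ := exists_selfAdjoint_sqrt hρ
  rw [ContinuousLinearMap.comp_apply, ← ContinuousLinearMap.adjoint_inner_left, hC,
    inner_self_eq_zero] at hx
  rw [ContinuousLinearMap.comp_apply, hx, map_zero]

theorem exists_unit_mem_range {P : E →L[ℂ] E} (hP : IsStarProjection P) (h0 : P ≠ 0) :
    ∃ e, ‖e‖ = 1 ∧ P e = e := by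
  obtain ⟨x, hx⟩ := DFunLike.ne_iff.1 h0
  have hPP : P (P x) = P x := DFunLike.congr_fun hP.isIdempotentElem x
  refine ⟨((‖P x‖ : ℂ)⁻¹) • P x, norm_smul_inv_norm hx, ?_⟩
  rw [map_smul, hPP]

variable {F : Type*} [NormedAddCommGroup F] [InnerProductSpace ℂ F] [CompleteSpace F]

theorem norm_compress_eq {C : E →L[ℂ] E} (hC : C.adjoint = C) (Y : F →L[ℂ] E) :
    ‖Y.adjoint ∘L (C ∘L C) ∘L Y‖ = ‖C ∘L Y‖ ^ 2 := by
  have h1 : Y.adjoint ∘L (C ∘L C) ∘L Y = (C ∘L Y).adjoint ∘L (C ∘L Y) := by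
    rw [ContinuousLinearMap.adjoint_comp, hC]; rfl
  rw [h1, sq]
  exact ContinuousLinearMap.norm_adjoint_comp_self _

theorem reflection_mem_unitary {P : E →L[ℂ] E} (hP : IsStarProjection P) :
    (2 : ℂ) • P - 1 ∈ unitary (E →L[ℂ] E) := by
  have h := hP.two_mul_sub_one_mem_unitary
  rwa [two_mul, ← two_smul ℂ P] at h

theorem orthonormal_unitary_comp {ι : Type*} {W : E →L[ℂ] E} (hW : W ∈ unitary (E →L[ℂ] E))
    {v : ι → E} (hv : Orthonormal ℂ v) : Orthonormal ℂ fun i => W (v i) :=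
  hv.comp_linearIsometry ⟨W.toLinearMap, fun x => ContinuousLinearMap.norm_map_of_mem_unitary hW x⟩

/-- Convergence of the compressions of the unnormalized state `X ρ X†` that a projection `P` between
two unitary evolutions leaves, `X = X₁ P X₂`. As `P = (1 + W) / 2` with the unitary reflection
`W = 2 P - 1`, each compression is controlled by those of `ρ` along two orthonormal systems. -/
theorem IsDensityOperator.summable_compress_conj {ρ : E →L[ℂ] E} (hρ : IsDensityOperator ρ)
    {X₁ P X₂ : E →L[ℂ] E} (h₁ : X₁ ∈ unitary (E →L[ℂ] E)) (hP : IsStarProjection P)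
    (h₂ : X₂ ∈ unitary (E →L[ℂ] E)) {ι κ : Type*} (b : HilbertBasis κ ℂ F) (V : ι → F →L[ℂ] E)
    (hV : Orthonormal ℂ fun p : ι × κ => V p.1 (b p.2)) :
    Summable fun i => ‖(V i).adjoint ∘L
      (X₁ ∘L (P ∘L (X₂ ∘L ρ ∘L X₂.adjoint) ∘L P.adjoint) ∘L X₁.adjoint) ∘L V i‖ := by
  obtain ⟨C, hC, hCC⟩ := exists_selfAdjoint_sqrt hρ.isPositive
  set W : E →L[ℂ] E := (2 : ℂ) • P - 1 with hW
  have hadj : (X₁ ∘L P ∘L X₂).adjoint = X₂.adjoint ∘L P ∘L X₁.adjoint := by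
    have : P.adjoint = P := hP.isSelfAdjoint
    rw [ContinuousLinearMap.adjoint_comp, ContinuousLinearMap.adjoint_comp, this]; rfl
  set Y₁ : ι → F →L[ℂ] E := fun i => X₂.adjoint ∘L X₁.adjoint ∘L V i with hY₁
  set Y₂ : ι → F →L[ℂ] E := fun i => X₂.adjoint ∘L W ∘L X₁.adjoint ∘L V i with hY₂
  have hu₁ : X₁.adjoint ∈ unitary (E →L[ℂ] E) := Unitary.star_mem h₁
  have hu₂ : X₂.adjoint ∈ unitary (E →L[ℂ] E) := Unitary.star_mem h₂
  have s₁ := hρ.summable_compress b Y₁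
    (orthonormal_unitary_comp hu₂ (orthonormal_unitary_comp hu₁ hV))
  have s₂ := hρ.summable_compress b Y₂
    (orthonormal_unitary_comp hu₂ (orthonormal_unitary_comp (reflection_mem_unitary hP)
      (orthonormal_unitary_comp hu₁ hV)))
  refine Summable.of_nonneg_of_le (fun i => norm_nonneg _) (fun i => ?_) (s₁.add s₂)
  have e1 : (V i).adjoint ∘L
        (X₁ ∘L (P ∘L (X₂ ∘L ρ ∘L X₂.adjoint) ∘L P.adjoint) ∘L X₁.adjoint) ∘L V i =
      ((X₁ ∘L P ∘L X₂).adjoint ∘L V i).adjoint ∘L (C ∘L C) ∘L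
        ((X₁ ∘L P ∘L X₂).adjoint ∘L V i) := by
    rw [ContinuousLinearMap.adjoint_comp _ (V i), ContinuousLinearMap.adjoint_adjoint, hCC,
      ContinuousLinearMap.adjoint_comp, ContinuousLinearMap.adjoint_comp]
    rfl
  have e2 : C ∘L ((X₁ ∘L P ∘L X₂).adjoint ∘L V i) =
      (2⁻¹ : ℂ) • (C ∘L Y₁ i + C ∘L Y₂ i) := by
    rw [hadj]
    ext x
    simp only [hY₁, hY₂, hW, ContinuousLinearMap.comp_apply, add_apply, smul_apply, sub_apply,
      map_sub, map_smul, one_apply_eq_self]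
    module
  have e3 : ‖C ∘L ((X₁ ∘L P ∘L X₂).adjoint ∘L V i)‖ ≤ 2⁻¹ * (‖C ∘L Y₁ i‖ + ‖C ∘L Y₂ i‖) := by
    rw [e2, norm_smul]
    refine mul_le_mul (by simp) (norm_add_le _ _) (norm_nonneg _) (by norm_num)
  rw [e1, norm_compress_eq hC, ← hCC, norm_compress_eq hC, norm_compress_eq hC]
  nlinarith [norm_nonneg (C ∘L ((X₁ ∘L P ∘L X₂).adjoint ∘L V i)), norm_nonneg (C ∘L Y₁ i),
    norm_nonneg (C ∘L Y₂ i), sq_nonneg (‖C ∘L Y₁ i‖ - ‖C ∘L Y₂ i‖)]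

theorem isDensityOperator_rankOne {v : E} (hv : ‖v‖ = 1) :
    IsDensityOperator (InnerProductSpace.rankOne ℂ v v) := by
  refine ⟨InnerProductSpace.isPositive_rankOne_self v, ?_⟩
  have h := (stdBasis E).hasSum_inner_mul_inner v v
  rw [inner_self_eq_norm_sq_to_K, hv] at h
  simpa [inner_smul_right] using h

theorem eq_conj_of_hasSum {ι : Type*} {f : ι → E →L[ℂ] E} {s P : E →L[ℂ] E} (hs : HasSum f s)
    (hf : ∀ i, P ∘L f i ∘L P.adjoint = f i) : s = P ∘L s ∘L P.adjoint := by
  have h1 := ((ContinuousLinearMap.compL ℂ E E E P).hasSum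
    (((ContinuousLinearMap.compL ℂ E E E).flip P.adjoint).hasSum hs))
  refine hs.unique ?_
  convert h1 using 1
  · exact funext fun i => (hf i).symm
  · rfl

end Positive

/-! ### Operators on the Hilbert space tensor product -/

section Tensor
variable {S M : Type*}
  [NormedAddCommGroup S] [InnerProductSpace ℂ S]
  [NormedAddCommGroup M] [InnerProductSpace ℂ M]

theorem HTensor.clm_ext {G : Type*} [NormedAddCommGroup G] [NormedSpace ℂ G]
    {f g : HTensor S M →L[ℂ] G} (h : ∀ x y, f (tmulLeft x y) = g (tmulLeft x y)) : f = g := by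
  ext z
  refine UniformSpace.Completion.induction_on z (isClosed_eq f.continuous g.continuous) fun a => ?_
  induction a using TensorProduct.induction_on with
  | zero => rw [UniformSpace.Completion.coe_zero, map_zero, map_zero]
  | tmul x y => exact h x y
  | add a b ha hb => rw [UniformSpace.Completion.coe_add, map_add, map_add, ha, hb]

theorem inner_tmulLeft (x x' : S) (y y' : M) :
    ⟪tmulLeft x y, tmulLeft x' y'⟫_ℂ = ⟪x, x'⟫_ℂ * ⟪y, y'⟫_ℂ :=
  (UniformSpace.Completion.inner_coe _ _).trans (TensorProduct.inner_tmul _ _ _ _ _)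

theorem onPointer_tmulLeft (Q : M →L[ℂ] M) (x : S) (y : M) :
    onPointer Q (tmulLeft x y) = tmulLeft x (Q y) :=
  ContinuousLinearMap.completion_apply_coe _ _

theorem onPointer_comp (Q Q' : M →L[ℂ] M) :
    onPointer (S := S) (Q ∘L Q') = onPointer Q ∘L onPointer Q' :=
  HTensor.clm_ext fun x y => by
    rw [ContinuousLinearMap.comp_apply, onPointer_tmulLeft, onPointer_tmulLeft, onPointer_tmulLeft]
    rfl

theorem onPointer_zero : onPointer (S := S) (0 : M →L[ℂ] M) = 0 :=
  HTensor.clm_ext fun x y => by rw [onPointer_tmulLeft]; simp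

theorem onPointer_adjoint [CompleteSpace M] (Q : M →L[ℂ] M) :
    (onPointer (S := S) Q).adjoint = onPointer Q.adjoint := by
  refine HTensor.clm_ext fun x y => ?_
  refine ext_inner_right ℂ fun z => ?_
  have : innerSL ℂ ((onPointer (S := S) Q).adjoint (tmulLeft x y)) =
      innerSL ℂ (onPointer Q.adjoint (tmulLeft x y)) := by
    refine HTensor.clm_ext fun x' y' => ?_
    rw [innerSL_apply_apply, innerSL_apply_apply, ContinuousLinearMap.adjoint_inner_left,
      onPointer_tmulLeft, onPointer_tmulLeft, inner_tmulLeft, inner_tmulLeft, ContinuousLinearMap.adjoint_inner_left]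
  exact DFunLike.congr_fun this z

theorem isStarProjection_onPointer [CompleteSpace M] {Q : M →L[ℂ] M} (hQ : IsStarProjection Q) :
    IsStarProjection (onPointer (S := S) Q) := by
  refine ⟨?_, ?_⟩
  · have : Q ∘L Q = Q := hQ.isIdempotentElem
    change onPointer Q ∘L onPointer Q = onPointer Q
    rw [← onPointer_comp, this]
  · have : Q.adjoint = Q := hQ.isSelfAdjoint
    change (onPointer Q).adjoint = onPointer Q
    rw [onPointer_adjoint, this]

theorem tmulLeft_adjoint [CompleteSpace M] (a x : S) (y : M) :
    (tmulLeft (M := M) a).adjoint (tmulLeft x y) = ⟪a, x⟫_ℂ • y :=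
  ext_inner_left ℂ fun z => by
    rw [ContinuousLinearMap.adjoint_inner_right, inner_tmulLeft, inner_smul_right]

theorem tmulRight_adjoint [CompleteSpace S] (b : M) (x : S) (y : M) :
    (tmulRight (S := S) b).adjoint (tmulLeft x y) = ⟪b, y⟫_ℂ • x :=
  ext_inner_left ℂ fun z => by
    rw [ContinuousLinearMap.adjoint_inner_right, inner_smul_right, mul_comm]
    exact inner_tmulLeft z x b y

end Tensor

/-! ### Pointer states -/

section Pointer
variable {S : Type*} {M : Type*}
  [NormedAddCommGroup S] [InnerProductSpace ℂ S] [CompleteSpace S]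
  [NormedAddCommGroup M] [InnerProductSpace ℂ M] [CompleteSpace M]
variable {A : SharpObservable S} {Z : SharpObservable M} {R B : Set ℝ}

/-- If the reduced state of the pointer lives on the range of `Π_B`, then the total state lives on
the range of `I ⊗ Π_B`: for `Π_B y = 0` the numbers `⟪eᵢ ⊗ y, ρ (eᵢ ⊗ y)⟫ ≥ 0` sum up to
`⟪y, (tr_S ρ) y⟫ = 0`. Without the summability `traceS ρ` could be the junk value `0`. -/
theorem PointerIn.onPointer_comp_eq {ρ : HTensor S M →L[ℂ] HTensor S M} (hpos : ρ.IsPositive)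
    (hsum : Summable fun i => ‖(tmulLeft (M := M) (stdBasis S i)).adjoint ∘L ρ ∘L
      tmulLeft (stdBasis S i)‖) (hB : MeasurableSet B) (h : PointerIn Z B ρ) :
    onPointer (Z.proj B) ∘L ρ = ρ := by
  have hP := Z.isStarProjection B hB
  have hPP : ∀ y, Z.proj B (Z.proj B y) = Z.proj B y := DFunLike.congr_fun hP.isIdempotentElem
  have hPa : (Z.proj B).adjoint = Z.proj B := hP.isSelfAdjoint
  have h0 : ∀ i y, Z.proj B y = 0 → ρ (tmulLeft (stdBasis S i) y) = 0 := by
    intro i y hy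
    have h1 : HasSum _ (traceS ρ) := hsum.of_norm.hasSum
    have h2 := Complex.hasSum_re ((innerSL ℂ y ∘L ContinuousLinearMap.apply ℂ M y).hasSum h1)
    have h3 : ((innerSL ℂ y ∘L ContinuousLinearMap.apply ℂ M y) (traceS ρ)).re = 0 := by
      have h4 : traceS ρ y = 0 := by
        rw [h, ContinuousLinearMap.comp_apply, ContinuousLinearMap.comp_apply, hPa, hy, map_zero,
          map_zero]
      simp [h4]
    have h5 : ∀ j, (⟪tmulLeft (stdBasis S j) y, ρ (tmulLeft (stdBasis S j) y)⟫_ℂ).re = 0 := by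
      rw [h3] at h2
      have h6 := (hasSum_zero_iff_of_nonneg (fun j => ?_)).1 h2
      · intro j
        rw [← ContinuousLinearMap.adjoint_inner_right]
        exact congrFun h6 j
      · change 0 ≤ (⟪y, (tmulLeft (M := M) (stdBasis S j)).adjoint _⟫_ℂ).re
        rw [ContinuousLinearMap.adjoint_inner_right]
        exact hpos.re_inner_nonneg_right _
    refine apply_eq_zero_of_inner_eq_zero hpos (Complex.ext (h5 i) ?_)
    exact (Complex.nonneg_iff.1 (hpos.inner_nonneg_right _)).2.symm
  have h1 : ∀ y, Z.proj B y = 0 → ∀ x, ρ (tmulLeft x y) = 0 := by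
    intro y hy x
    have hd : Dense (Submodule.span ℂ (Set.range (stdBasis S)) : Set S) :=
      (Submodule.dense_iff_topologicalClosure_eq_top).2 (stdBasis S).dense_span
    have h2 : ρ ∘L tmulRight y = 0 := ContinuousLinearMap.ext_on hd (by
      rintro _ ⟨i, rfl⟩
      exact h0 i y hy)
    exact DFunLike.congr_fun h2 x
  have h2 : ρ ∘L onPointer (Z.proj B) = ρ := HTensor.clm_ext fun x y => by
    have h3 := h1 (y - Z.proj B y) (by rw [map_sub, hPP, sub_self]) x
    rw [map_sub, map_sub, sub_eq_zero] at h3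
    rw [ContinuousLinearMap.comp_apply, onPointer_tmulLeft, h3]
  have h3 := congrArg ContinuousLinearMap.adjoint h2
  have h4 : ρ.adjoint = ρ := hpos.isSelfAdjoint
  rwa [ContinuousLinearMap.adjoint_comp, onPointer_adjoint, hPa, h4] at h3

theorem SharpObservable.proj_comp_of_disjoint (Z : SharpObservable M) (hR : MeasurableSet R)
    (hB : MeasurableSet B) (hRB : Disjoint R B) : Z.proj R ∘L Z.proj B = 0 := by
  rw [← Z.proj_inter R B hR hB, hRB.inter_eq]
  ext x
  have h := Z.hasSum_iUnion (fun _ => ∅) (fun _ => MeasurableSet.empty)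
    (fun _ _ _ => disjoint_bot_left) x
  simpa using (summable_const_iff _).1 h.summable

theorem pointerIn_rankOne {e : S} {f : M}
    (hv : ‖tmulLeft e f‖ = 1) (hf : Z.proj R f = f) :
    PointerIn Z R (InnerProductSpace.rankOne ℂ (tmulLeft e f) (tmulLeft e f)) := by
  refine eq_conj_of_hasSum (summable_traceS (isDensityOperator_rankOne hv)).of_norm.hasSum
    fun i => ?_
  simp only [InnerProductSpace.comp_rankOne, InnerProductSpace.rankOne_comp, tmulLeft_adjoint,
    ContinuousLinearMap.adjoint_adjoint, map_smul (Z.proj R), hf]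

theorem systemIn_rankOne {e : S} {f : M}
    (hv : ‖tmulLeft e f‖ = 1) (he : A.proj B e = e) :
    SystemIn A B (InnerProductSpace.rankOne ℂ (tmulLeft e f) (tmulLeft e f)) := by
  refine eq_conj_of_hasSum (summable_traceM (isDensityOperator_rankOne hv)).of_norm.hasSum
    fun i => ?_
  simp only [InnerProductSpace.comp_rankOne, InnerProductSpace.rankOne_comp, tmulRight_adjoint,
    ContinuousLinearMap.adjoint_adjoint, map_smul (A.proj B), he]

end Pointer

/-! ### Impossibility of accurate measurements and preparations -/

section Impossibility
variable {S : Type*} {M : Type*}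
  [NormedAddCommGroup S] [InnerProductSpace ℂ S] [CompleteSpace S]
  [NormedAddCommGroup M] [InnerProductSpace ℂ M] [CompleteSpace M]
variable {ħ : ℝ} {H : HTensor S M →ₗ.[ℂ] HTensor S M} {U : ℝ → HTensor S M →L[ℂ] HTensor S M}
  {A : SharpObservable S} {Z : SharpObservable M} {R B : Set ℝ} {T T' : ℝ}
  {ρ : HTensor S M →L[ℂ] HTensor S M}

/-- A pointer that stays in `B` during an interval of time is in `B` at all times, past and
future. -/
theorem IsEvolution.onPointer_comp_eq_of_interval (hħ : 0 < ħ) (hH : IsSelfAdjoint H)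
    (hbelow : IsBoundedBelow H) (hU : IsEvolution ħ H U) (hB : MeasurableSet B)
    (hpos : ρ.IsPositive)
    (hsum : ∀ t, Summable fun i => ‖(tmulLeft (M := M) (stdBasis S i)).adjoint ∘L
      evolve U t ρ ∘L tmulLeft (stdBasis S i)‖)
    {a b : ℝ} (hab : a < b) (h : ∀ t ∈ Set.Ioo a b, PointerIn Z B (evolve U t ρ)) (t : ℝ) :
    onPointer (Z.proj B) ∘L U t ∘L ρ = U t ∘L ρ := by
  ext x
  have key := hU.apply_eq_zero_of_interval hħ hH hbelow (1 - onPointer (Z.proj B)) hab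
    (φ := ρ x) (fun s hs => ?_) t
  · rw [sub_apply, one_apply_eq_self, sub_eq_zero] at key
    exact key.symm
  · have h1 := (h s hs).onPointer_comp_eq (hpos.conj_adjoint (U s)) (hsum s) hB
    have h2 : (U s).adjoint (U s x) = x :=
      DFunLike.congr_fun (Unitary.star_mul_self_of_mem (hU.mem_unitary s)) x
    have h3 := DFunLike.congr_fun h1 (U s x)
    simp only [ContinuousLinearMap.comp_apply, h2] at h3
    rw [sub_apply, one_apply_eq_self, h3, sub_self]

theorem IsEvolution.summable_project (hU : IsEvolution ħ H U) (hρ : IsDensityOperator ρ)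
    (hB : MeasurableSet B) (s t : ℝ) :
    Summable fun i => ‖(tmulLeft (M := M) (stdBasis S i)).adjoint ∘L
      evolve U s (project Z B (evolve U t ρ)) ∘L tmulLeft (stdBasis S i)‖ := by
  have h := hρ.summable_compress_conj (hU.mem_unitary s)
    (isStarProjection_onPointer (S := S) (Z.isStarProjection B hB)) (hU.mem_unitary t) (stdBasis M)
    (fun i => tmulLeft (M := M) (stdBasis S i))
    (orthonormal_basis_tmul (stdBasis S).orthonormal (stdBasis M).orthonormal)
  exact h

theorem IsEvolution.summable_evolve (hU : IsEvolution ħ H U) (hρ : IsDensityOperator ρ) (t : ℝ) :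
    Summable fun i => ‖(tmulLeft (M := M) (stdBasis S i)).adjoint ∘L
      evolve U t ρ ∘L tmulLeft (stdBasis S i)‖ := by
  have h := hρ.summable_compress (stdBasis M)
    (fun i => (U t).adjoint ∘L tmulLeft (M := M) (stdBasis S i))
    (orthonormal_unitary_comp (Unitary.star_mem (hU.mem_unitary t))
      (orthonormal_basis_tmul (stdBasis S).orthonormal (stdBasis M).orthonormal))
  simpa only [evolve, ContinuousLinearMap.adjoint_comp, ContinuousLinearMap.adjoint_adjoint,
    ContinuousLinearMap.comp_assoc] using h

/-- The pointer that stays in `B` during `(T, T')` is in `B` already at the time `0`, when it is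
also in the disjoint set `R`; hence `ρ = 0`. -/
theorem not_accurateMeasurementRun (hħ : 0 < ħ) (hH : IsSelfAdjoint H)
    (hbelow : IsBoundedBelow H) (hU : IsEvolution ħ H U) (hR : MeasurableSet R)
    (hB : MeasurableSet B) (hRB : Disjoint R B) (hT : T < T') :
    ¬ AccurateMeasurementRun U A Z R B T T' ρ := fun h => by
  have h1 := hU.onPointer_comp_eq_of_interval hħ hH hbelow hB h.density.isPositive
    (hU.summable_evolve h.density) hT h.persistent 0
  have h2 := h.ready.onPointer_comp_eq h.density.isPositive (summable_traceS h.density) hR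
  have h3 : onPointer (Z.proj B) ∘L ρ = ρ := by rwa [hU.zero] at h1
  have h4 : ρ = 0 := by
    rw [← h2, ← h3, ← ContinuousLinearMap.comp_assoc, ← onPointer_comp,
      Z.proj_comp_of_disjoint hR hB hRB, onPointer_zero, ContinuousLinearMap.zero_comp]
  have h5 := h.density.trace_eq_one
  simp only [h4, zero_apply, inner_zero_right] at h5
  exact zero_ne_one (hasSum_zero.unique h5)

/-- Evolved back to the time `0`, the projected state `σ` has its pointer in `B`, so it is
annihilated by `ρ`, whose pointer is in `R`. As `σ` is obtained from `ρ` by conjugation, this gives `σ² = 0`. -/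
theorem not_accuratePreparationRun (hħ : 0 < ħ) (hH : IsSelfAdjoint H)
    (hbelow : IsBoundedBelow H) (hU : IsEvolution ħ H U) (hR : MeasurableSet R)
    (hB : MeasurableSet B) (hRB : Disjoint R B) (hT : T < T') :
    ¬ AccuratePreparationRun U A Z R B T T' ρ := fun h => by
  set σ := project Z B (evolve U T ρ) with hσ
  have hQ := isStarProjection_onPointer (S := S) (Z.isStarProjection B hB)
  have hQa : (onPointer (S := S) (Z.proj B)).adjoint = onPointer (Z.proj B) := hQ.isSelfAdjoint
  have hQQ : ∀ x, onPointer (S := S) (Z.proj B) (onPointer (Z.proj B) x) = onPointer (Z.proj B) x :=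
    DFunLike.congr_fun hQ.isIdempotentElem
  have hpos : σ.IsPositive :=
    (h.density.isPositive.conj_adjoint (U T)).conj_adjoint (onPointer (Z.proj B))
  have hσx : ∀ x, σ x = onPointer (Z.proj B) (U T (ρ ((U T).adjoint (onPointer (Z.proj B) x)))) :=
    fun x => by rw [hσ, project, hQa]; rfl
  have h1 := hU.onPointer_comp_eq_of_interval (Z := Z) (B := B) hħ hH hbelow hB hpos
    (fun s => hU.summable_project h.density hB s T) (sub_pos.2 hT)
    (fun s hs => by
      have := h.persistent (s + T) ⟨by linarith [hs.1], by linarith [hs.2]⟩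
      rwa [add_sub_cancel_right] at this) (-T)
  have h2 := h.ready.onPointer_comp_eq h.density.isPositive (summable_traceS h.density) hR
  have h2' : ρ ∘L onPointer (Z.proj R) = ρ := by
    have hRa : (onPointer (S := S) (Z.proj R)).adjoint = onPointer (Z.proj R) :=
      (isStarProjection_onPointer (Z.isStarProjection R hR)).isSelfAdjoint
    have hρa : ρ.adjoint = ρ := h.density.isPositive.isSelfAdjoint
    have := congrArg ContinuousLinearMap.adjoint h2
    rwa [ContinuousLinearMap.adjoint_comp, hRa, hρa] at this
  have hUa : ∀ x, (U T).adjoint x = U (-T) x := fun x => by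
    have h3 : U T (U (-T) x) = x := by
      rw [← hU.add_apply, add_neg_cancel, hU.zero, one_apply_eq_self]
    have h4 : (U T).adjoint (U T (U (-T) x)) = U (-T) x :=
      DFunLike.congr_fun (Unitary.star_mul_self_of_mem (hU.mem_unitary T)) _
    rwa [h3] at h4
  have h3 : ∀ x, ρ (U (-T) (σ x)) = 0 := fun x => by
    have h4 : onPointer (Z.proj B) (U (-T) (σ x)) = U (-T) (σ x) := DFunLike.congr_fun h1 x
    have h5 : onPointer (S := S) (Z.proj R) ∘L onPointer (Z.proj B) = 0 := by
      rw [← onPointer_comp, Z.proj_comp_of_disjoint hR hB hRB, onPointer_zero]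
    have h6 : onPointer (Z.proj R) (U (-T) (σ x)) = 0 := by
      rw [← h4]; exact DFunLike.congr_fun h5 _
    rw [← h2', ContinuousLinearMap.comp_apply, h6, map_zero]
  refine h.occurs (ContinuousLinearMap.ext fun x => ?_)
  have h4 : onPointer (Z.proj B) (σ x) = σ x := by rw [hσx, hQQ]
  have h5 : σ (σ x) = 0 := by rw [hσx (σ x), h4, hUa, h3, map_zero, map_zero]
  have h6 : ⟪σ x, σ x⟫_ℂ = 0 := by
    rw [hpos.inner_left_eq_inner_right, h5, inner_zero_right]
  exact inner_self_eq_zero.1 h6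

/-- The initial state is the product of a vector in the range of `P_B` and one in the range of
`Π_R`; for it the equivalence and the persistence would give an accurate measurement run. -/
theorem not_isAccurateMeasurement (hħ : 0 < ħ) (hH : IsSelfAdjoint H)
    (hbelow : IsBoundedBelow H) (hU : IsEvolution ħ H U) (hR : MeasurableSet R)
    (hZR : Z.proj R ≠ 0) (hB : MeasurableSet B) (hRB : Disjoint R B) (hT : T < T')
    (hAB : A.proj B ≠ 0) : ¬ IsAccurateMeasurement U A Z R B T T' := fun h => by
  obtain ⟨e, he, heB⟩ := exists_unit_mem_range (A.isStarProjection B hB) hAB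
  obtain ⟨f, hf, hfR⟩ := exists_unit_mem_range (Z.isStarProjection R hR) hZR
  have hv : ‖tmulLeft e f‖ = 1 := by
    refine (UniformSpace.Completion.norm_coe _).trans ((TensorProduct.norm_tmul e f).trans ?_)
    rw [he, hf, one_mul]
  have hd := isDensityOperator_rankOne hv
  have ha := pointerIn_rankOne hv hfR
  have hb := systemIn_rankOne hv heB
  obtain ⟨h1, h2⟩ := h _ hd ha
  exact not_accurateMeasurementRun hħ hH hbelow hU hR hB hRB hT ⟨hd, ha, hb, h1.1 hb, h2 hb⟩

end Impossibility

end QuantumMeasurement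

open QuantumMeasurement in
theorem theorem2 {S : Type*} {M : Type*}
    [NormedAddCommGroup S] [InnerProductSpace ℂ S] [CompleteSpace S]
    [NormedAddCommGroup M] [InnerProductSpace ℂ M] [CompleteSpace M]
    (ħ : ℝ) (hħ : 0 < ħ)
    (H : HTensor S M →ₗ.[ℂ] HTensor S M) (hH : IsSelfAdjoint H) (hbelow : IsBoundedBelow H)
    (U : ℝ → HTensor S M →L[ℂ] HTensor S M) (hU : IsEvolution ħ H U)
    (A : SharpObservable S) (Z : SharpObservable M)
    (R : Set ℝ) (hR : MeasurableSet R) (hZR : Z.proj R ≠ 0)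
    (B : Set ℝ) (hB : MeasurableSet B) (hRB : Disjoint R B)
    (T T' : ℝ) (hT : T < T') :
    (∀ ρ₀, ¬ AccurateMeasurementRun U A Z R B T T' ρ₀) ∧
    (A.proj B ≠ 0 → ¬ IsAccurateMeasurement U A Z R B T T') ∧
    (∀ ρ₀, ¬ AccuratePreparationRun U A Z R B T T' ρ₀) ∧
    ¬ IsAccuratePreparation U A Z R B T T' := by
  refine ⟨fun _ => not_accurateMeasurementRun hħ hH hbelow hU hR hB hRB hT,
    not_isAccurateMeasurement hħ hH hbelow hU hR hZR hB hRB hT,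
    fun _ => not_accuratePreparationRun hħ hH hbelow hU hR hB hRB hT, ?_⟩
  rintro ⟨⟨ρ₀, hd, ha, he⟩, h⟩
  obtain ⟨hf, hg⟩ := h ρ₀ hd ha he
  exact not_accuratePreparationRun hħ hH hbelow hU hR hB hRB hT ⟨hd, ha, he, hf, hg⟩
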